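/- \textbf{Semi-online bipartite matching.} An instance consists of a finite bipartite graph $G$ with offline side $U$ and online side $V = V_P \sqcup V_A$ (predicted and adversarial nodes) together with an arrival order of $V$. The \emph{predicted graph} $H$ is the subgraph of $G$ induced on $U \cup V_P$. A randomized algorithm knows $H$ in advance and nothing about the number of adversarial nodes, their edges or the arrival order. The nodes of $V$ then arrive one at a time in the given order; on arrival of a node its set of neighbours in $U$ is revealed (and nothing else), and the algorithm must irrevocably either match it to a still unmatched neighbour or abandon it. The instance is fixed before the random choices of the algorithm are made. Let $\nu(I)$ denote the size of a maximum matching of a graph $I$, and put $\delta = 1 - \nu(H)/\nu(G)$. \textbf{Theorem.} There is a randomized algorithm for semi-online bipartite matching such that on every instance, whether or not $G$ has a perfect matching, the expected size of the matching that it builds is at least $$\Bigl(1 - \delta + \delta^2\bigl(1 - \tfrac1e\bigr)\Bigr)\,\nu(G).$$ (If $\nu(G) = 0$, then $\delta$ is not defined and the bound is read as $0$.) -/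

import Mathlib

/-! Semi-online bipartite matching.  A bipartite graph with offline side `U` and online side `V` is
given by the neighbourhood function `N : V → Finset U` of its online nodes. -/

namespace SemiOnline

universe u v w

/-- `M` is a matching of the bipartite graph `N`: all its pairs are edges, and two different pairs
share neither their online nor their offline end. -/
def IsMatching {V : Type w} {U : Type u} (N : V → Finset U) (M : Finset (V × U)) : Prop :=
  (∀ e ∈ M, e.2 ∈ N e.1) ∧ ∀ e ∈ M, ∀ f ∈ M, e.1 = f.1 ∨ e.2 = f.2 → e = f

open Classical in
/-- The size `ν` of a maximum matching. -/
noncomputable def matchingNumber {V : Type w} {U : Type u} [Fintype V] [Fintype U]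
    (N : V → Finset U) : ℕ :=
  (Finset.univ.filter fun M : Finset (V × U) => IsMatching N M).sup Finset.card

/-- A deterministic online strategy.  It sees the neighbourhoods of the online nodes that arrived
so far (oldest first) and the neighbourhood of the node arriving now, and answers with the offline
node to which the arriving node is to be matched, or with `none` to abandon it.  Earlier answers
are determined by the history, so they need not be passed on. -/
abbrev OnlineStrategy (U : Type u) : Type u := List (Finset U) → Finset U → Option U

open Classical in
/-- One irrevocable decision: the arriving node `v` is matched to the answered node `u` if `u` is a
still unmatched neighbour of `v`; in all other cases `v` is abandoned. -/
noncomputable def step {V : Type w} {U : Type u} (N : V → Finset U) (M : Finset (V × U)) (v : V) :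
    Option U → Finset (V × U)
  | none => M
  | some x => if x ∈ N v ∧ ∀ e ∈ M, e.2 ≠ x then insert (v, x) M else M

/-- The online phase, continued from history `h` and current matching `M`, on the nodes that are
still to arrive (in the order of the list). -/
noncomputable def runFrom {V : Type w} {U : Type u} (A : OnlineStrategy U) (N : V → Finset U) :
    List (Finset U) → Finset (V × U) → List V → Finset (V × U)
  | _, M, [] => M
  | h, M, v :: vs => runFrom A N (h ++ [N v]) (step N M v (A h (N v))) vs

/-- The matching that the strategy `A` has built when all nodes have arrived. -/
noncomputable def run {V : Type w} {U : Type u} (A : OnlineStrategy U) (N : V → Finset U)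
    (order : List V) : Finset (V × U) :=
  runFrom A N [] ∅ order

/-- The expected size of the matching built by a random online strategy. -/
noncomputable def expectedSize {V : Type w} {U : Type u} (A : PMF (OnlineStrategy U))
    (N : V → Finset U) (order : List V) : ℝ :=
  ∑' s : OnlineStrategy U, (A s).toReal * ((run s N order).card : ℝ)

/-- A randomized semi-online algorithm.  Its only advance knowledge is the predicted graph `H` on
the offline nodes `U` and the predicted online nodes `P`; from it the algorithm draws at random a
strategy for the online phase. -/
def RandomizedAlgorithm : Type (max (u + 1) (v + 1)) :=
  ∀ (U : Type u) (P : Type v) [Fintype U] [Fintype P], (P → Finset U) → PMF (OnlineStrategy U)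

/-- The real graph: its online nodes are the predicted ones, with their predicted neighbourhoods,
and `d` adversarial ones, with neighbourhoods `adv`. -/
def fullGraph {U : Type u} {P : Type v} (H : P → Finset U) {d : ℕ} (adv : Fin d → Finset U) :
    P ⊕ Fin d → Finset U :=
  Sum.elim H adv

/-- `δ = 1 - ν(H) / ν(G)`. -/
noncomputable def delta {U : Type u} {P : Type v} [Fintype U] [Fintype P] (H : P → Finset U)
    {d : ℕ} (adv : Fin d → Finset U) : ℝ :=
  1 - (matchingNumber H : ℝ) / (matchingNumber (fullGraph H adv) : ℝ)

end SemiOnline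

/-! The algorithm draws a maximum matching `M` of the predicted graph at random, reserves the nodes
covered by `M` for predicted arrivals, and runs RANKING on the other offline nodes for all other
arrivals. An arrival counts as predicted when its neighbourhood equals that of a predicted node
still awaited. A mistaken identification is harmless, because it only permutes nodes with equal
neighbourhoods. All of `M` gets built, which gives ν(H). By an exchange argument
(`exists_split_maximum`), some maximum matching of G consists of a maximum matching `B` of H and a
set `O` of δν(G) edges at unidentified arrivals. An edge of `O` is usable by RANKING unless `M`
covers its offline end. The law of `M` maximises the product of the probabilities p(u) that u stays
uncovered. Optimality against the point mass at `B` bounds the sum of 1/p over the offline ends of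
`O` by |B| + |O| = ν(G). By Cauchy–Schwarz (`exists_fair_distribution`), the expected number of
usable edges is at least |O|²/ν(G) = δ²ν(G). RANKING secures a 1 - 1/e fraction of them
(`exists_ranking_distribution`), by the primal-dual argument with finitely many labels and a limit.
-/

namespace SemiOnline

universe u v w

open Filter Topology

/-! ### A fair distribution by maximising a product -/

/-- First-order optimality of a product of positive affine functions. -/
theorem sum_div_le_card_of_prod_le {ι : Type*} (W : Finset ι) (p q : ι → ℝ)
    (hp : ∀ i ∈ W, 0 < p i)
    (hmax : ∀ ε : ℝ, 0 < ε → ε < 1 → ∏ i ∈ W, (p i + ε * (q i - p i)) ≤ ∏ i ∈ W, p i) :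
    ∑ i ∈ W, q i / p i ≤ W.card := by
  classical
  have hd : HasDerivAt (fun ε : ℝ => ∏ i ∈ W, (p i + ε * (q i - p i)))
      (∑ i ∈ W, (∏ j ∈ W.erase i, (p j + 0 * (q j - p j))) • (q i - p i)) 0 := by
    apply HasDerivAt.fun_finsetProd
    intro i _
    simpa using ((hasDerivAt_id (0 : ℝ)).mul_const (q i - p i)).const_add (p i)
  have hle : ∑ i ∈ W, (∏ j ∈ W.erase i, (p j + 0 * (q j - p j))) • (q i - p i) ≤ 0 := by
    have ht := (hasDerivAt_iff_tendsto_slope.1 hd).mono_left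
      (nhdsWithin_mono (0 : ℝ) (s := Set.Ioi 0) (fun x hx => ne_of_gt hx))
    refine le_of_tendsto ht ?_
    filter_upwards [Ioo_mem_nhdsGT (zero_lt_one' ℝ)] with ε hε
    have h := hmax ε hε.1 hε.2
    rw [slope_def_field]
    apply div_nonpos_of_nonpos_of_nonneg
    · simpa using h
    · linarith [hε.1]
  have hP : 0 < ∏ i ∈ W, p i := Finset.prod_pos hp
  have hrew : ∑ i ∈ W, (∏ j ∈ W.erase i, (p j + 0 * (q j - p j))) • (q i - p i)
      = (∏ i ∈ W, p i) * (∑ i ∈ W, q i / p i - W.card) := by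
    rw [Finset.card_eq_sum_ones, Nat.cast_sum, ← Finset.sum_sub_distrib, Finset.mul_sum]
    refine Finset.sum_congr rfl fun i hi => ?_
    rw [← Finset.mul_prod_erase W p hi]
    have := (hp i hi).ne'
    simp only [zero_mul, add_zero, smul_eq_mul]
    field_simp
    push_cast
    ring
  rw [hrew] at hle
  nlinarith [nonpos_of_mul_nonpos_right hle hP]

/-- For a finite family of sets there is a distribution on it under which every set disjoint from a
member of the family is avoided often. -/
theorem exists_fair_distribution {B : Type*} {U : Type*} [Fintype B] [Nonempty B] [Fintype U]
    [DecidableEq U] (cov : B → Finset U) :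
    ∃ w ∈ stdSimplex ℝ B, ∀ (b₀ : B) (D : Finset U), Disjoint D (cov b₀) →
      (D.card : ℝ) ^ 2 ≤
        (∑ d ∈ D, ∑ b, w b * (if d ∈ cov b then 0 else 1)) * ((cov b₀).card + D.card) := by
  classical
  set p : (B → ℝ) → U → ℝ := fun w u => ∑ b, w b * (if u ∈ cov b then 0 else 1) with hpdef
  -- Nodes covered by every member have avoidance probability zero for all `w` and would annihilate
  -- the product.
  set W : Finset U := Finset.univ.filter fun u => ∃ b, u ∉ cov b with hW
  have hcont : Continuous fun w : B → ℝ => ∏ u ∈ W, p w u := by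
    simp only [hpdef]; fun_prop
  obtain ⟨w, hw, hmax⟩ := (isCompact_stdSimplex ℝ B).exists_isMaxOn
    ⟨_, single_mem_stdSimplex ℝ (Classical.arbitrary B)⟩ hcont.continuousOn
  refine ⟨w, hw, fun b₀ D hD => ?_⟩
  have hp0 : ∀ u, 0 ≤ p w u := fun u => Finset.sum_nonneg fun b _ =>
    mul_nonneg (hw.1 b) (by split_ifs <;> norm_num)
  have hp1 : ∀ u, p w u ≤ 1 := fun u => by
    rw [← hw.2]
    refine Finset.sum_le_sum fun b _ => ?_
    have := hw.1 b
    split_ifs <;> linarith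
  -- The uniform weights make every factor positive, hence so does the maximiser.
  have hpos : 0 < ∏ u ∈ W, p w u := by
    have hc : (0 : ℝ) < Fintype.card B := by exact_mod_cast Fintype.card_pos
    have hu : (fun _ : B => (Fintype.card B : ℝ)⁻¹) ∈ stdSimplex ℝ B :=
      ⟨fun _ => by positivity, by simp [hc.ne']⟩
    refine lt_of_lt_of_le (Finset.prod_pos fun u hu => ?_) (hmax hu)
    obtain ⟨b, hb⟩ := (Finset.mem_filter.1 hu).2
    refine Finset.sum_pos' (fun b _ => ?_) ⟨b, Finset.mem_univ _, ?_⟩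
    · split_ifs <;> simp
    · simp only [hb, if_false]; positivity
  have hpW : ∀ u ∈ W, 0 < p w u := fun u hu =>
    lt_of_le_of_ne (hp0 u) fun h => hpos.ne' (Finset.prod_eq_zero hu h.symm)
  -- Perturb towards the point mass at `b₀`: `p` is linear in the weights, and its value at the
  -- point mass is the indicator of not being covered by `b₀`.
  have key := sum_div_le_card_of_prod_le W (p w) (fun u => if u ∈ cov b₀ then 0 else 1) hpW
    (fun ε h0 h1 => by
      have hmem : (1 - ε) • w + ε • (Pi.single b₀ 1 : B → ℝ) ∈ stdSimplex ℝ B :=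
        convex_stdSimplex ℝ B hw (single_mem_stdSimplex ℝ b₀) (by linarith) h0.le (by ring)
      refine le_trans (le_of_eq ?_) (hmax hmem)
      refine Finset.prod_congr rfl fun u _ => ?_
      have hs : ∑ b, (Pi.single b₀ 1 : B → ℝ) b * (if u ∈ cov b then (0 : ℝ) else 1)
          = if u ∈ cov b₀ then 0 else 1 := by
        rw [Finset.sum_eq_single b₀ (fun b _ hb => by rw [Pi.single_eq_of_ne hb, zero_mul])
          (by simp), Pi.single_eq_same, one_mul]
      simp only [hpdef, Pi.add_apply, Pi.smul_apply, smul_eq_mul, add_mul, Finset.sum_add_distrib,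
        mul_assoc, ← Finset.mul_sum, hs]
      ring)
  have hDW : D ⊆ W := fun d hd =>
    Finset.mem_filter.2 ⟨Finset.mem_univ _, b₀, Finset.disjoint_left.1 hD hd⟩
  have hinv : ∑ d ∈ D, 1 / p w d ≤ (cov b₀).card + D.card := by
    have h1 : ∑ u ∈ D, (if u ∈ cov b₀ then 0 else 1) / p w u = ∑ d ∈ D, 1 / p w d :=
      Finset.sum_congr rfl fun d hd => by rw [if_neg (Finset.disjoint_left.1 hD hd)]
    -- Outside `D`, a node is either covered by `b₀` or contributes `1 / p ≥ 1`; removing these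
    -- contributions from `key` leaves the bound for `D`.
    have h2 : ((W \ D).card : ℝ) ≤
        (cov b₀).card + ∑ u ∈ W \ D, (if u ∈ cov b₀ then 0 else 1) / p w u := by
      have h3 : ((W \ D).card : ℝ) ≤ ∑ u ∈ W \ D, ((if u ∈ cov b₀ then 1 else 0) +
          (if u ∈ cov b₀ then 0 else 1) / p w u) := by
        rw [Finset.card_eq_sum_ones, Nat.cast_sum]
        refine Finset.sum_le_sum fun u hu => ?_
        have hu' := hpW u (Finset.mem_sdiff.1 hu).1
        split_ifs
        · simp
        · have := (one_le_div hu').2 (hp1 u)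
          simpa using this
      rw [Finset.sum_add_distrib] at h3
      have h4 : ∑ u ∈ W \ D, (if u ∈ cov b₀ then (1 : ℝ) else 0) ≤ (cov b₀).card := by
        rw [Finset.sum_boole]
        exact_mod_cast Finset.card_le_card fun u hu => (Finset.mem_filter.1 hu).2
      linarith
    have h5 := Finset.sum_sdiff (f := fun u => (if u ∈ cov b₀ then (0 : ℝ) else 1) / p w u) hDW
    have h6 : (W.card : ℝ) = (W \ D).card + D.card := by
      exact_mod_cast (Finset.card_sdiff_add_card_eq_card hDW).symm
    linarith
  have hcs := Finset.sum_sq_le_sum_mul_sum_of_sq_le_mul D (r := fun _ => (1 : ℝ)) (f := p w)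
    (g := fun d => 1 / p w d) (fun d _ => hp0 d) (fun d _ => one_div_nonneg.2 (hp0 d))
    (fun d hd => by have := (hpW d (hDW hd)).ne'; simp [this])
  simp only [Finset.sum_const, nsmul_eq_mul, mul_one] at hcs
  exact hcs.trans (mul_le_mul_of_nonneg_left hinv (Finset.sum_nonneg fun d _ => hp0 d))

/-! ### Greedy matching under a fixed preference order -/

/-- `c` chooses from every nonempty set its element of smallest key. -/
def IsArgmin {U : Type*} {K : Type*} [LinearOrder K] (k : U → K) (c : Finset U → Option U) : Prop :=
  ∀ S u, c S = some u ↔ u ∈ S ∧ ∀ x ∈ S, k u ≤ k x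

theorem IsArgmin.mem {U : Type*} {K : Type*} [LinearOrder K] {k : U → K}
    {c : Finset U → Option U} (hc : IsArgmin k c) (S : Finset U) (u : U) (h : c S = some u) :
    u ∈ S :=
  ((hc S u).1 h).1

theorem exists_isArgmin {U : Type*} {K : Type*} [LinearOrder K] {k : U → K}
    (hk : Function.Injective k) : ∃ c, IsArgmin k c := by
  classical
  refine ⟨fun S => if h : ∃ u ∈ S, ∀ x ∈ S, k u ≤ k x then some h.choose else none,
    fun S u => ?_⟩
  by_cases h : ∃ u ∈ S, ∀ x ∈ S, k u ≤ k x
  · simp only [dif_pos h, Option.some.injEq]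
    have hs := h.choose_spec
    refine ⟨fun e => e ▸ hs, fun hu => hk (le_antisymm (hs.2 u hu.1) (hu.2 _ hs.1))⟩
  · simp only [dif_neg h, reduceCtorEq, false_iff]
    exact fun hu => h ⟨u, hu⟩

section Greedy

variable {V : Type*} {U : Type*} [DecidableEq V] [DecidableEq U]

/-- The matching built by giving every arriving node its chosen free neighbour. -/
def greedy (c : Finset U → Option U) (N : V → Finset U) : Finset U → List V → Finset (V × U)
  | _, [] => ∅
  | F, v :: vs =>
    match c (F ∩ N v) with
    | none => greedy c N F vs
    | some x => insert (v, x) (greedy c N (F.erase x) vs)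

variable {c : Finset U → Option U} {N : V → Finset U} {F F' : Finset U} {v : V} {vs : List V}

theorem greedy_cons_none (h : c (F ∩ N v) = none) :
    greedy c N F (v :: vs) = greedy c N F vs := by
  rw [greedy, h]

theorem greedy_cons_some {x : U} (h : c (F ∩ N v) = some x) :
    greedy c N F (v :: vs) = insert (v, x) (greedy c N (F.erase x) vs) := by
  rw [greedy, h]

theorem mem_greedy (hc : ∀ S x, c S = some x → x ∈ S) {e : V × U}
    (he : e ∈ greedy c N F vs) : e.1 ∈ vs ∧ e.2 ∈ F ∧ e.2 ∈ N e.1 := by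
  induction vs generalizing F with
  | nil => simp [greedy] at he
  | cons v vs ih =>
    cases h : c (F ∩ N v) with
    | none =>
      rw [greedy_cons_none h] at he
      have := ih he
      exact ⟨List.mem_cons_of_mem _ this.1, this.2⟩
    | some x =>
      rw [greedy_cons_some h, Finset.mem_insert] at he
      rcases he with rfl | he
      · have := Finset.mem_inter.1 (hc _ _ h)
        exact ⟨by simp, this⟩
      · have := ih he
        exact ⟨List.mem_cons_of_mem _ this.1, Finset.mem_of_mem_erase this.2.1, this.2.2⟩

theorem card_greedy_cons_some (hc : ∀ S x, c S = some x → x ∈ S) {x : U}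
    (h : c (F ∩ N v) = some x) :
    (greedy c N F (v :: vs)).card = (greedy c N (F.erase x) vs).card + 1 := by
  rw [greedy_cons_some h, Finset.card_insert_of_notMem]
  intro hmem
  simpa using (mem_greedy hc hmem).2.1

/-- The inclusion of the free sets survives every arrival, so with more free nodes an online node
never fares worse. -/
theorem greedy_mono {K : Type*} [LinearOrder K] {k : U → K} (hc : IsArgmin k c) (hF : F ⊆ F')
    {a : V} {x : U} (h : (a, x) ∈ greedy c N F vs) :
    ∃ z, (a, z) ∈ greedy c N F' vs ∧ k z ≤ k x := by
  induction vs generalizing F F' with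
  | nil => simp [greedy] at h
  | cons v vs ih =>
    -- A choice made only in the larger run lies outside `F`, so its removal keeps the inclusion.
    have out : ∀ z, c (F' ∩ N v) = some z → c (F ∩ N v) ≠ some z → z ∉ F := by
      intro z hz hne hzF
      have hz' := (hc _ _).1 hz
      refine hne ((hc _ _).2 ⟨Finset.mem_inter.2 ⟨hzF, (Finset.mem_inter.1 hz'.1).2⟩, ?_⟩)
      exact fun t ht => hz'.2 t (Finset.inter_subset_inter_right hF ht)
    cases h' : c (F' ∩ N v) with
    | none =>
      rw [greedy_cons_none h']
      cases h1 : c (F ∩ N v) with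
      | none =>
        rw [greedy_cons_none h1] at h
        exact ih hF h
      | some y =>
        exfalso
        have hy := (hc _ _).1 h1
        obtain ⟨t, ht, hmin⟩ := Finset.exists_min_image (F' ∩ N v) k
          ⟨y, Finset.inter_subset_inter_right hF hy.1⟩
        rw [(hc _ t).2 ⟨ht, hmin⟩] at h'
        exact absurd h' (by simp)
    | some z =>
      rw [greedy_cons_some h']
      cases h1 : c (F ∩ N v) with
      | none =>
        rw [greedy_cons_none h1] at h
        have hz := out z h' (by simp [h1])
        obtain ⟨t, ht⟩ := ih (F' := F'.erase z)
          (fun s hs => Finset.mem_erase.2 ⟨fun e => hz (e ▸ hs), hF hs⟩) h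
        exact ⟨t, Finset.mem_insert_of_mem ht.1, ht.2⟩
      | some y =>
        rw [greedy_cons_some h1] at h
        have hsub : F.erase y ⊆ F'.erase z := by
          by_cases hyz : y = z
          · subst hyz; exact Finset.erase_subset_erase _ hF
          · have hz := out z h' (by simpa [h1] using hyz)
            exact fun s hs => Finset.mem_erase.2
              ⟨fun e => hz (e ▸ Finset.mem_of_mem_erase hs), hF (Finset.mem_of_mem_erase hs)⟩
        rcases Finset.mem_insert.1 h with he | h
        · obtain ⟨rfl, rfl⟩ := Prod.mk.inj he
          refine ⟨z, Finset.mem_insert_self _ _, ?_⟩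
          exact ((hc _ _).1 h').2 _ (Finset.inter_subset_inter_right hF ((hc _ _).1 h1).1)
        · obtain ⟨t, ht⟩ := ih hsub h
          exact ⟨t, Finset.mem_insert_of_mem ht.1, ht.2⟩

theorem IsArgmin.erase {K : Type*} [LinearOrder K] {k : U → K} (hc : IsArgmin k c)
    {S : Finset U} {d : U} (h : c S ≠ some d) : c (S.erase d) = c S := by
  by_cases hS : S.Nonempty
  · obtain ⟨t, ht, hmin⟩ := Finset.exists_min_image S k hS
    have e := (hc S t).2 ⟨ht, hmin⟩
    rw [e]
    refine (hc _ _).2 ⟨Finset.mem_erase.2 ⟨fun h' => h (h' ▸ e), ht⟩, ?_⟩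
    exact fun x hx => hmin x (Finset.mem_of_mem_erase hx)
  · rw [Finset.not_nonempty_iff_eq_empty.1 hS]; simp

/-- A minimum is unaffected by deleting an element that is not the minimum. -/
theorem greedy_erase_of_unmatched {K : Type*} [LinearOrder K] {k : U → K} (hc : IsArgmin k c)
    {d : U} (hd : ∀ a, (a, d) ∉ greedy c N F vs) :
    greedy c N (F.erase d) vs = greedy c N F vs := by
  induction vs generalizing F with
  | nil => simp [greedy]
  | cons v vs ih =>
    have hne : c (F ∩ N v) ≠ some d := fun h => hd v (by rw [greedy_cons_some h]; simp)
    have he : c (F.erase d ∩ N v) = c (F ∩ N v) := by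
      rw [Finset.erase_inter]; exact hc.erase hne
    cases h : c (F ∩ N v) with
    | none =>
      rw [greedy_cons_none h, greedy_cons_none (he.trans h)]
      exact ih fun a ha => hd a (by rwa [greedy_cons_none h])
    | some x =>
      rw [greedy_cons_some h, greedy_cons_some (he.trans h), Finset.erase_right_comm]
      congr 1
      exact ih fun a ha => hd a (by rw [greedy_cons_some h]; exact Finset.mem_insert_of_mem ha)

/-- If `d` is never taken, it is still a candidate when `a` arrives. -/
theorem exists_mem_greedy_of_unmatched {K : Type*} [LinearOrder K] {k : U → K}
    (hc : IsArgmin k c) {d : U} (hd : ∀ a, (a, d) ∉ greedy c N F vs) (hdF : d ∈ F) {a : V}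
    (ha : a ∈ vs) (hda : d ∈ N a) : ∃ z, (a, z) ∈ greedy c N F vs ∧ k z ≤ k d := by
  induction vs generalizing F with
  | nil => simp at ha
  | cons v vs ih =>
    have hne : c (F ∩ N v) ≠ some d := fun h => hd v (by rw [greedy_cons_some h]; simp)
    cases h : c (F ∩ N v) with
    | none =>
      rw [greedy_cons_none h] at hd ⊢
      rcases List.mem_cons.1 ha with rfl | ha
      · exfalso
        obtain ⟨t, ht, hmin⟩ := Finset.exists_min_image (F ∩ N a) k
          ⟨d, Finset.mem_inter.2 ⟨hdF, hda⟩⟩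
        rw [(hc _ t).2 ⟨ht, hmin⟩] at h
        exact absurd h (by simp)
      · exact ih hd hdF ha
    | some x =>
      rw [greedy_cons_some h] at hd ⊢
      rcases List.mem_cons.1 ha with rfl | ha
      · exact ⟨x, Finset.mem_insert_self _ _,
          ((hc _ _).1 h).2 d (Finset.mem_inter.2 ⟨hdF, hda⟩)⟩
      · obtain ⟨z, hz⟩ := ih (F := F.erase x) (fun a ha => hd a (Finset.mem_insert_of_mem ha))
          (Finset.mem_erase.2 ⟨fun e => hne (e ▸ h), hdF⟩) ha
        exact ⟨z, Finset.mem_insert_of_mem hz.1, hz.2⟩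

theorem greedy_congr {c' : Finset U → Option U} {d : U} (hcc : ∀ S, d ∉ S → c S = c' S)
    (hd : d ∉ F) : greedy c N F vs = greedy c' N F vs := by
  induction vs generalizing F with
  | nil => simp [greedy]
  | cons v vs ih =>
    have he := hcc (F ∩ N v) fun h => hd (Finset.mem_inter.1 h).1
    cases h : c (F ∩ N v) with
    | none => rw [greedy_cons_none h, greedy_cons_none (he ▸ h), ih hd]
    | some x =>
      rw [greedy_cons_some h, greedy_cons_some (he ▸ h), ih]
      exact fun h => hd (Finset.mem_of_mem_erase h)

end Greedy

/-! ### RANKING with finitely many labels -/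

/-- Ties between equal labels are broken by `e`. -/
def labelKey {U : Type*} {T n : ℕ} (e : U ≃ Fin n) (y : U → Fin T) (u : U) : Fin T ×ₗ Fin n :=
  toLex (y u, e u)

theorem labelKey_injective {U : Type*} {T n : ℕ} (e : U ≃ Fin n) (y : U → Fin T) :
    Function.Injective (labelKey e y) := by
  intro a b h
  have := congrArg (fun z => (ofLex z).2) h
  exact e.injective this

theorem label_le_of_labelKey_le {U : Type*} {T n : ℕ} {e : U ≃ Fin n} {y : U → Fin T} {a b : U}
    (h : labelKey e y a ≤ labelKey e y b) : y a ≤ y b := by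
  rcases Prod.Lex.le_iff.1 h with h | h
  · exact h.le
  · exact h.1.le

/-- The choice of the neighbour with the smallest label. -/
noncomputable def rankChoice {U : Type*} {T n : ℕ} (e : U ≃ Fin n) (y : U → Fin T) :
    Finset U → Option U :=
  (exists_isArgmin (labelKey_injective e y)).choose

theorem rankChoice_isArgmin {U : Type*} {T n : ℕ} (e : U ≃ Fin n) (y : U → Fin T) :
    IsArgmin (labelKey e y) (rankChoice e y) :=
  (exists_isArgmin (labelKey_injective e y)).choose_spec

theorem rankChoice_update {U : Type*} [DecidableEq U] {T n : ℕ} (e : U ≃ Fin n) (y : U → Fin T)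
    (d : U) (j : Fin T) (S : Finset U) (hd : d ∉ S) :
    rankChoice e (Function.update y d j) S = rankChoice e y S := by
  have key : ∀ u ∈ S, labelKey e (Function.update y d j) u = labelKey e y u := fun u hu => by
    have : u ≠ d := fun h => hd (h ▸ hu)
    simp [labelKey, this]
  apply Option.ext
  intro u
  rw [rankChoice_isArgmin e _ S u, rankChoice_isArgmin e y S u]
  refine and_congr_right fun hu => forall₂_congr fun x hx => ?_
  rw [key u hu, key x hx]

/-- Resampling one coordinate preserves the uniform law: exchanging `y d` with `j` is an involution.
-/
theorem sum_sum_update {U : Type*} {A : Type*} [Fintype U] [DecidableEq U] [Fintype A]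
    (d : U) (f : (U → A) → ℝ) :
    ∑ y : U → A, ∑ j : A, f (Function.update y d j) = Fintype.card A * ∑ y : U → A, f y := by
  rw [← Fintype.sum_prod_type' (f := fun y j => f (Function.update y d j))]
  have hinv : Function.Involutive
      (fun z : (U → A) × A => (Function.update z.1 d z.2, z.1 d)) := by
    rintro ⟨y, j⟩; simp
  rw [← Equiv.sum_comp (hinv.toPerm _)]
  simp [Fintype.sum_prod_type, Finset.mul_sum]

/-- The share of the value of a matched pair that its offline end receives. -/
noncomputable def share (T : ℕ) (j : ℕ) : ℝ := (1 + 1 / (T : ℝ)) ^ j / (1 + 1 / (T : ℝ)) ^ T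

theorem share_mono {T i j : ℕ} (h : i ≤ j) : share T i ≤ share T j := by
  have : (1 : ℝ) ≤ 1 + 1 / (T : ℝ) := by simp
  unfold share
  gcongr

theorem share_self (T : ℕ) : share T T = 1 :=
  div_self (by positivity)

theorem share_nonneg (T j : ℕ) : 0 ≤ share T j := by unfold share; positivity

/-- The left side does not depend on `m`, since `share` grows by `share T m / T` at each step. This
is the discrete form of ∫₀^γ e^(y-1) dy + 1 - e^(γ-1) = 1 - 1/e. -/
theorem sum_share {T : ℕ} (hT : 0 < T) (m : ℕ) :
    ∑ j ∈ Finset.range m, share T j + T * (1 - share T m) =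
      T * (1 - 1 / (1 + 1 / (T : ℝ)) ^ T) := by
  have hT' : (T : ℝ) ≠ 0 := by positivity
  induction m with
  | zero => simp [share]
  | succ m ih =>
    rw [Finset.sum_range_succ, ← ih]
    have : share T (m + 1) = share T m * (1 + 1 / (T : ℝ)) := by
      simp only [share, pow_succ]; ring
    rw [this]
    field_simp
    ring

section Ranking

variable {V : Type*} {U : Type*} [DecidableEq V] [DecidableEq U]

/-- The value that an edge of the optimum collects from the pairs of the greedy matching that it
meets. -/
noncomputable def edgeGain {T : ℕ} (y : U → Fin T) (M : Finset (V × U)) (f : V × U) : ℝ :=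
  ∑ e ∈ M, ((if e.2 = f.2 then share T (y e.2) else 0) +
    (if e.1 = f.1 then 1 - share T (y e.2) else 0))

/-- Every pair of `M` splits one unit between its two ends, and each end meets at most one edge of
`O`. -/
theorem sum_edgeGain_le_card {N : V → Finset U} {T : ℕ} (y : U → Fin T) (M : Finset (V × U))
    {O : Finset (V × U)} (hO : IsMatching N O) : ∑ f ∈ O, edgeGain y M f ≤ M.card := by
  unfold edgeGain
  rw [Finset.sum_comm, Finset.card_eq_sum_ones, Nat.cast_sum]
  refine Finset.sum_le_sum fun e _ => ?_
  have h1 : 0 ≤ 1 - share T (y e.2) := by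
    have := share_mono (T := T) (y e.2).2.le
    rw [share_self] at this; linarith
  have aux : ∀ (q : V × U → Prop) [DecidablePred q] (r : ℝ), 0 ≤ r →
      (∀ f ∈ O, ∀ g ∈ O, q f → q g → f = g) → ∑ f ∈ O, (if q f then r else 0) ≤ r := by
    intro q _ r hr hq
    rw [← Finset.sum_filter, Finset.sum_const, nsmul_eq_mul]
    have : (O.filter q).card ≤ 1 := Finset.card_le_one.2 fun f hf g hg =>
      hq f (Finset.mem_filter.1 hf).1 g (Finset.mem_filter.1 hg).1 (Finset.mem_filter.1 hf).2
        (Finset.mem_filter.1 hg).2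
    exact mul_le_of_le_one_left hr (by exact_mod_cast this)
  rw [Finset.sum_add_distrib]
  have a := aux (fun f => e.2 = f.2) _ (share_nonneg T (y e.2))
    (fun f hf g hg h h' => hO.2 f hf g hg (Or.inr (h.symm.trans h')))
  have b := aux (fun f => e.1 = f.1) _ h1
    (fun f hf g hg h h' => hO.2 f hf g hg (Or.inl (h.symm.trans h')))
  push_cast
  linarith

/-- Fix all labels but that of `d = f.2`. The label γ that `a = f.1` obtains when `d` is absent is a
threshold: `d` is matched whenever its own label is below γ, and `a` always obtains a label at most
γ. Then `sum_share` applies, whatever γ is. -/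
theorem sum_edgeGain_update {T n : ℕ} (hT : 0 < T) (e : U ≃ Fin n) (N : V → Finset U)
    (F : Finset U) (vs : List V) (f : V × U) (hf : f.2 ∈ F) (hfv : f.1 ∈ vs) (hfN : f.2 ∈ N f.1)
    (y : U → Fin T) :
    T * (1 - 1 / (1 + 1 / (T : ℝ)) ^ T) ≤ ∑ j : Fin T,
      edgeGain (Function.update y f.2 j)
        (greedy (rankChoice e (Function.update y f.2 j)) N F vs) f := by
  obtain ⟨a, d⟩ := f
  simp only at hf hfv hfN ⊢
  set G := greedy (rankChoice e y) N (F.erase d) vs with hG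
  have hGe : ∀ j, greedy (rankChoice e (Function.update y d j)) N (F.erase d) vs = G := fun j =>
    greedy_congr (rankChoice_update e y d j) (by simp)
  have hterm : ∀ z : V × U, ∀ y : U → Fin T,
      0 ≤ (if z.2 = d then share T (y z.2) else 0) ∧
      0 ≤ (if z.1 = a then 1 - share T (y z.2) else 0) := by
    intro z y
    have := share_mono (T := T) (y z.2).2.le
    rw [share_self] at this
    have := share_nonneg T (y z.2)
    constructor <;> split_ifs <;> linarith
  have hd : ∀ (y : U → Fin T) (M : Finset (V × U)) (b : V), (b, d) ∈ M →
      share T (y d) ≤ ∑ z ∈ M, if z.2 = d then share T (y z.2) else 0 := by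
    intro y M b hb
    have := Finset.single_le_sum (f := fun z : V × U => if z.2 = d then share T (y z.2) else 0)
      (fun z _ => (hterm z y).1) hb
    simpa using this
  have ha : ∀ (y : U → Fin T) (M : Finset (V × U)) (x : U), (a, x) ∈ M →
      1 - share T (y x) ≤ ∑ z ∈ M, if z.1 = a then 1 - share T (y z.2) else 0 := by
    intro y M x hx
    have := Finset.single_le_sum
      (f := fun z : V × U => if z.1 = a then 1 - share T (y z.2) else 0)
      (fun z _ => (hterm z y).2) hx
    simpa using this
  suffices hs : ∃ γ : ℕ, γ ≤ T ∧ ∀ j : Fin T, (if (j : ℕ) < γ then share T j else 0) +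
      (1 - share T γ) ≤ edgeGain (Function.update y d j)
        (greedy (rankChoice e (Function.update y d j)) N F vs) (a, d) by
    obtain ⟨γ, hγ, h⟩ := hs
    refine le_trans (le_of_eq ?_) (Finset.sum_le_sum fun j _ => h j)
    rw [← sum_share hT γ, Finset.sum_add_distrib]
    congr 1
    · rw [Fin.sum_univ_eq_sum_range (fun j => if j < γ then share T j else 0) T,
        ← Finset.sum_filter]
      congr 1
      ext i
      simp only [Finset.mem_range, Finset.mem_filter]
      omega
    · simp [mul_sub]
  -- If `d` stays unmatched, its deletion changes nothing, so the partner of `a` already appears in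
  -- `G`.
  have free : ∀ j : Fin T,
      (∀ b, (b, d) ∉ greedy (rankChoice e (Function.update y d j)) N F vs) →
      ∃ x, (a, x) ∈ G ∧ y x ≤ j := by
    intro j hj
    have hc := rankChoice_isArgmin e (Function.update y d j)
    obtain ⟨x, hx, hxd⟩ := exists_mem_greedy_of_unmatched hc hj hf hfv hfN
    have hxd' := label_le_of_labelKey_le hxd
    rw [← greedy_erase_of_unmatched hc hj, hGe] at hx
    have hne : x ≠ d := (Finset.mem_erase.1 (mem_greedy (rankChoice_isArgmin e y).mem hx).2.1).1
    exact ⟨x, hx, by simpa [hne] using hxd'⟩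
  have gain : ∀ (j : Fin T) (r : ℝ), r ≤ (∑ z ∈ greedy (rankChoice e (Function.update y d j)) N F
      vs, if z.1 = a then 1 - share T (Function.update y d j z.2) else 0) → ∀ γ : ℕ,
      ((∀ b, (b, d) ∉ greedy (rankChoice e (Function.update y d j)) N F vs) → γ ≤ j) →
      (if (j : ℕ) < γ then share T j else 0) + r ≤ edgeGain (Function.update y d j)
        (greedy (rankChoice e (Function.update y d j)) N F vs) (a, d) := by
    intro j r hr γ hγ
    rw [edgeGain, Finset.sum_add_distrib]
    refine add_le_add ?_ hr
    split_ifs with hj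
    · have : ∃ b, (b, d) ∈ greedy (rankChoice e (Function.update y d j)) N F vs := by
        by_contra hcon
        push Not at hcon
        have := hγ hcon
        omega
      obtain ⟨b, hb⟩ := this
      have := hd (Function.update y d j) _ b hb
      simpa using this
    · exact Finset.sum_nonneg fun z _ => (hterm z _).1
  by_cases hx : ∃ x, (a, x) ∈ G
  -- The list `vs` may repeat `a`, so `a` may have several partners; the smallest label is the
  -- threshold.
  · obtain ⟨x, hx, hmin⟩ : ∃ x, (a, x) ∈ G ∧ ∀ z, (a, z) ∈ G → y x ≤ y z := by
      obtain ⟨p, hp, hmin⟩ := Finset.exists_min_image (G.filter fun z => z.1 = a) (fun z => y z.2)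
        (by obtain ⟨x, hx⟩ := hx; exact ⟨(a, x), by simp [hx]⟩)
      have hp' := Finset.mem_filter.1 hp
      refine ⟨p.2, ?_, fun z hz => hmin (a, z) (by simp [hz])⟩
      rw [← hp'.2]; exact hp'.1
    refine ⟨y x, (y x).2.le, fun j => gain j _ ?_ _ ?_⟩
    · have hc := rankChoice_isArgmin e (Function.update y d j)
      have hxj := hx
      rw [← hGe j] at hxj
      obtain ⟨z, hz, hzx⟩ := greedy_mono hc (Finset.erase_subset d F) hxj
      have hle := label_le_of_labelKey_le hzx
      have hne : x ≠ d := (Finset.mem_erase.1 (mem_greedy (rankChoice_isArgmin e y).mem hx).2.1).1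
      rw [Function.update_of_ne hne] at hle
      have := share_mono (T := T) (Fin.le_def.1 hle)
      have := ha (Function.update y d j) _ z hz
      linarith
    · intro hj
      obtain ⟨z, hz, hzj⟩ := free j hj
      exact Fin.le_def.1 ((hmin z hz).trans hzj)
  -- If `a` is unmatched without `d`, then `d` is matched under every label; `share T T = 1` leaves
  -- nothing to claim from `a`.
  · refine ⟨T, le_rfl, fun j => gain j _ ?_ _ ?_⟩
    · rw [share_self, sub_self]
      exact Finset.sum_nonneg fun z _ => (hterm z _).2
    · intro hj
      obtain ⟨z, hz, _⟩ := free j hj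
      exact absurd ⟨z, hz⟩ hx

theorem ranking_labels_bound [Fintype U] {T n : ℕ} (hT : 0 < T) (e : U ≃ Fin n)
    (N : V → Finset U) (F : Finset U) (vs : List V) {O : Finset (V × U)} (hO : IsMatching N O)
    (hOF : ∀ f ∈ O, f.1 ∈ vs ∧ f.2 ∈ F) :
    (T : ℝ) ^ Fintype.card U * ((1 - 1 / (1 + 1 / (T : ℝ)) ^ T) * O.card) ≤
      ∑ y : U → Fin T, ((greedy (rankChoice e y) N F vs).card : ℝ) := by
  have hT' : (0 : ℝ) < T := by exact_mod_cast hT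
  refine le_trans ?_ (Finset.sum_le_sum fun y _ =>
    sum_edgeGain_le_card y (greedy (rankChoice e y) N F vs) hO)
  rw [Finset.sum_comm]
  have : ∀ f ∈ O, (T : ℝ) ^ Fintype.card U * (1 - 1 / (1 + 1 / (T : ℝ)) ^ T) ≤
      ∑ y : U → Fin T, edgeGain y (greedy (rankChoice e y) N F vs) f := by
    intro f hf
    have h1 := sum_sum_update f.2
      (fun y : U → Fin T => edgeGain y (greedy (rankChoice e y) N F vs) f)
    have h2 := Finset.sum_le_sum fun (y : U → Fin T) (_ : y ∈ Finset.univ) =>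
      sum_edgeGain_update hT e N F vs f (hOF f hf).2 (hOF f hf).1 (hO.1 f hf) y
    rw [h1] at h2
    simp only [Finset.sum_const, Finset.card_univ, Fintype.card_fun, Fintype.card_fin,
      nsmul_eq_mul, Nat.cast_pow] at h2
    refine le_of_mul_le_mul_left ?_ hT'
    linarith
  have h := Finset.sum_le_sum this
  rw [Finset.sum_const, nsmul_eq_mul] at h
  linarith

end Ranking

/-- Under a suitable law of the preferences, RANKING finds in expectation a `1 - 1 / e`
fraction of every matching. -/
theorem exists_ranking_distribution (U : Type u) [Fintype U] [DecidableEq U] :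
    ∃ μ ∈ stdSimplex ℝ (Finset U → Option U),
      (∀ c, μ c ≠ 0 → ∀ S x, c S = some x → x ∈ S) ∧ ∀ (V : Type w) [DecidableEq V] (N : V → Finset U)
      (F : Finset U) (vs : List V) (O : Finset (V × U)), IsMatching N O →
      (∀ f ∈ O, f.1 ∈ vs ∧ f.2 ∈ F) →
      (1 - 1 / Real.exp 1) * O.card ≤ ∑ c, μ c * ((greedy c N F vs).card : ℝ) := by
  classical
  set e := Fintype.equivFin U
  set m : ℕ → (Finset U → Option U) → ℝ := fun T c =>
    ((Finset.univ.filter fun y : U → Fin (T + 1) => rankChoice e y = c).card : ℝ) /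
      ((T + 1 : ℕ) : ℝ) ^ Fintype.card U with hm
  have hsum : ∀ T (f : (Finset U → Option U) → ℝ), ∑ c, m T c * f c =
      (∑ y : U → Fin (T + 1), f (rankChoice e y)) / ((T + 1 : ℕ) : ℝ) ^ Fintype.card U := by
    intro T f
    rw [← Finset.sum_fiberwise Finset.univ (fun y : U → Fin (T + 1) => rankChoice e y),
      Finset.sum_div]
    refine Finset.sum_congr rfl fun c _ => ?_
    rw [Finset.sum_congr rfl fun y hy => by rw [(Finset.mem_filter.1 hy).2], Finset.sum_const,
      nsmul_eq_mul]
    simp only [hm]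
    ring
  have hmem : ∀ T, m T ∈ stdSimplex ℝ (Finset U → Option U) := by
    intro T
    refine ⟨fun c => by simp only [hm]; positivity, ?_⟩
    have := hsum T fun _ => 1
    simp only [mul_one] at this
    rw [this]
    rw [Finset.sum_const, Finset.card_univ, Fintype.card_fun, Fintype.card_fin, nsmul_eq_mul,
      mul_one, Nat.cast_pow]
    exact div_self (by positivity)
  -- There are finitely many choice rules, so the laws for `T + 1` labels have a limit point. It
  -- does not depend on the graph, and it attains 1 - 1/e without continuous labels.
  obtain ⟨μ, hμ, φ, hφ, hlim⟩ := (isCompact_stdSimplex ℝ _).tendsto_subseq hmem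
  refine ⟨μ, hμ, fun c hc0 => ?_, fun V _ N F vs O hO hOF => ?_⟩
  · by_contra hbad
    refine hc0 (tendsto_nhds_unique (tendsto_pi_nhds.1 hlim c) ?_)
    have h0 : ∀ T, m T c = 0 := by
      intro T
      have : (Finset.univ.filter fun y : U → Fin (T + 1) => rankChoice e y = c) = ∅ :=
        Finset.filter_eq_empty_iff.2 fun y _ hy => hbad (hy ▸ (rankChoice_isArgmin e y).mem)
      simp only [hm, this, Finset.card_empty, Nat.cast_zero, zero_div]
    exact tendsto_const_nhds.congr fun i => (h0 (φ i)).symm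
  have hlim' : Tendsto (fun i => ∑ c, m (φ i) c * ((greedy c N F vs).card : ℝ)) atTop
      (𝓝 (∑ c, μ c * ((greedy c N F vs).card : ℝ))) :=
    tendsto_finsetSum _ fun c _ => ((tendsto_pi_nhds.1 hlim) c).mul_const _
  have hexp : Tendsto (fun i => (1 - 1 / (1 + 1 / ((φ i + 1 : ℕ) : ℝ)) ^ (φ i + 1)) *
      (O.card : ℝ)) atTop (𝓝 ((1 - 1 / Real.exp 1) * O.card)) := by
    have h0 : Tendsto (fun n : ℕ => (1 + 1 / (n : ℝ)) ^ n) atTop (𝓝 (Real.exp 1)) :=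
      Real.tendsto_one_add_div_pow_exp 1
    have h1 := h0.comp ((tendsto_add_atTop_nat 1).comp hφ.tendsto_atTop)
    exact (tendsto_const_nhds.sub (tendsto_const_nhds.div h1 (Real.exp_pos 1).ne')).mul_const _
  refine le_of_tendsto_of_tendsto' hexp hlim' fun i => ?_
  rw [hsum, le_div_iff₀ (by positivity), mul_comm]
  exact ranking_labels_bound (Nat.succ_pos _) e N F vs hO hOF

/-! ### Exchange arguments for maximum matchings -/

theorem IsMatching.mono {V : Type*} {U : Type*} {N : V → Finset U} {M M' : Finset (V × U)}
    (hM : IsMatching N M) (h : M' ⊆ M) : IsMatching N M' :=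
  ⟨fun e he => hM.1 e (h he), fun e he f hf => hM.2 e (h he) f (h hf)⟩

theorem IsMatching.card_le_matchingNumber {V : Type*} {U : Type*} [Fintype V] [Fintype U]
    {N : V → Finset U} {M : Finset (V × U)} (hM : IsMatching N M) :
    M.card ≤ matchingNumber N := by
  classical
  exact Finset.le_sup (f := Finset.card) (Finset.mem_filter.2 ⟨Finset.mem_univ _, hM⟩)

theorem exists_isMatching_card_eq {V : Type*} {U : Type*} [Fintype V] [Fintype U]
    (N : V → Finset U) : ∃ M, IsMatching N M ∧ M.card = matchingNumber N := by
  classical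
  obtain ⟨M, hM, h⟩ := Finset.exists_mem_eq_sup
    (Finset.univ.filter fun M : Finset (V × U) => IsMatching N M)
    ⟨∅, by simp [IsMatching]⟩ Finset.card
  exact ⟨M, (Finset.mem_filter.1 hM).2, h.symm⟩

theorem IsMatching.insert {V : Type*} {U : Type*} [DecidableEq V] [DecidableEq U]
    {N : V → Finset U} {M : Finset (V × U)} (hM : IsMatching N M) {x : V × U} (hx : x.2 ∈ N x.1)
    (hfree : ∀ f ∈ M, ¬ (x.1 = f.1 ∨ x.2 = f.2)) : IsMatching N (insert x M) := by
  refine ⟨fun e he => ?_, fun e he f hf hef => ?_⟩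
  · rcases Finset.mem_insert.1 he with rfl | he
    exacts [hx, hM.1 e he]
  · rcases Finset.mem_insert.1 he with rfl | he' <;> rcases Finset.mem_insert.1 hf with rfl | hf'
    · rfl
    · exact absurd hef (hfree f hf')
    · exact absurd (hef.imp Eq.symm Eq.symm) (hfree e he')
    · exact hM.2 e he' f hf' hef

/-- Every matching can be traded for a maximum matching that covers the same online nodes. -/
theorem exists_maximum_covering {V : Type*} {U : Type*} [Fintype V] [Fintype U] [DecidableEq V]
    [DecidableEq U] {N : V → Finset U} {M₀ : Finset (V × U)} (h₀ : IsMatching N M₀) :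
    ∃ M, IsMatching N M ∧ M.card = matchingNumber N ∧ ∀ e ∈ M₀, ∃ f ∈ M, f.1 = e.1 := by
  classical
  obtain ⟨M₁, hM₁⟩ := exists_isMatching_card_eq N
  -- Among maximum matchings, take one sharing most edges with `M₀`. If it misses the online end of
  -- `e ∈ M₀`, then either `e` can be added, or swapping `e` in for the edge at its offline end
  -- increases the overlap.
  obtain ⟨M, hM, hmax⟩ := Finset.exists_max_image
    (Finset.univ.filter fun M => IsMatching N M ∧ M.card = matchingNumber N)
    (fun M => (M ∩ M₀).card) ⟨M₁, by simpa using hM₁⟩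
  obtain ⟨hM, hcard⟩ := (Finset.mem_filter.1 hM).2
  refine ⟨M, hM, hcard, fun e he => ?_⟩
  by_contra hno
  push Not at hno
  have heM : e ∉ M := fun h => hno e h rfl
  by_cases hu : ∃ f ∈ M, f.2 = e.2
  · obtain ⟨f, hf, hfe⟩ := hu
    have hf₀ : f ∉ M₀ := fun h => heM (h₀.2 f h e he (Or.inr hfe) ▸ hf)
    have heE : e ∉ M.erase f := fun h => heM (Finset.mem_of_mem_erase h)
    have hM' : IsMatching N (insert e (M.erase f)) := by
      refine (hM.mono (Finset.erase_subset _ _)).insert (h₀.1 e he) fun g hg hor => ?_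
      have hg' := Finset.mem_erase.1 hg
      rcases hor with h | h
      · exact hno g hg'.2 h.symm
      · exact hg'.1 (hM.2 g hg'.2 f hf (Or.inr (h.symm.trans hfe.symm)))
    have hc' : (insert e (M.erase f)).card = matchingNumber N := by
      rw [Finset.card_insert_of_notMem heE, Finset.card_erase_add_one hf, hcard]
    have := hmax _ (by simpa using ⟨hM', hc'⟩)
    have hlt : (M ∩ M₀).card < ((insert e (M.erase f)) ∩ M₀).card := by
      refine Finset.card_lt_card (Finset.ssubset_iff_of_subset ?_ |>.2 ⟨e, by simp [he], ?_⟩)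
      · intro g hg
        have hg' := Finset.mem_inter.1 hg
        exact Finset.mem_inter.2 ⟨Finset.mem_insert_of_mem
          (Finset.mem_erase.2 ⟨fun h => hf₀ (h ▸ hg'.2), hg'.1⟩), hg'.2⟩
      · simp [heM]
    omega
  · push Not at hu
    have hM' := (hM.insert (h₀.1 e he) fun f hf hor =>
      hor.elim (fun h => hno f hf h.symm) (fun h => hu f hf h.symm)).card_le_matchingNumber
    rw [Finset.card_insert_of_notMem heM] at hM'
    omega

/-- The offline nodes covered by a matching. -/
def covered {V : Type*} {U : Type*} [DecidableEq U] (M : Finset (V × U)) : Finset U :=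
  M.image Prod.snd

theorem IsMatching.card_covered {V : Type*} {U : Type*} [DecidableEq U] {N : V → Finset U}
    {M : Finset (V × U)} (hM : IsMatching N M) : (covered M).card = M.card :=
  Finset.card_image_of_injOn fun e he f hf h => hM.2 e he f hf (Or.inr h)

/-- If `σ` embeds `H` into `N`, a maximum matching of `N` splits into a maximum matching of `H` and
edges at the remaining online nodes. -/
theorem exists_split_maximum {V : Type*} {U : Type*} {P : Type*} [Fintype V] [Fintype U]
    [Fintype P] [DecidableEq U] {N : V → Finset U} {H : P → Finset U} {σ : P → V}
    (hσ : Function.Injective σ) (hN : ∀ p, N (σ p) = H p) :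
    ∃ (B : Finset (P × U)) (O : Finset (V × U)), IsMatching H B ∧ B.card = matchingNumber H ∧
      IsMatching N O ∧ B.card + O.card = matchingNumber N ∧
      (∀ e ∈ O, ∀ p, σ p ≠ e.1) ∧ Disjoint (covered O) (covered B) := by
  classical
  set ι : P × U ↪ V × U := ⟨Prod.map σ id, hσ.prodMap Function.injective_id⟩ with hι
  obtain ⟨B₀, hB₀, hB₀c⟩ := exists_isMatching_card_eq H
  have hpush : IsMatching N (B₀.map ι) := by
    refine ⟨fun e he => ?_, fun e he f hf hef => ?_⟩
    · obtain ⟨b, hb, rfl⟩ := Finset.mem_map.1 he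
      simpa [hι, hN] using hB₀.1 b hb
    · obtain ⟨b, hb, rfl⟩ := Finset.mem_map.1 he
      obtain ⟨b', hb', rfl⟩ := Finset.mem_map.1 hf
      rw [hB₀.2 b hb b' hb' (by simpa [hι, hσ.eq_iff] using hef)]
  obtain ⟨M, hM, hMc, hcov⟩ := exists_maximum_covering hpush
  set B : Finset (P × U) := Finset.univ.filter fun b => ι b ∈ M with hBdef
  set O : Finset (V × U) := M.filter fun e => ∀ p, σ p ≠ e.1 with hOdef
  have hBM : B.map ι = M.filter fun e => ¬ ∀ p, σ p ≠ e.1 := by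
    ext ⟨a, x⟩
    simp only [Finset.mem_map, Finset.mem_filter, hBdef, Finset.mem_univ, true_and]
    push Not
    constructor
    · rintro ⟨b, hb, he⟩
      exact ⟨he ▸ hb, b.1, congrArg Prod.fst he⟩
    · rintro ⟨h, p, hp⟩
      subst hp
      exact ⟨(p, x), h, rfl⟩
  have hB : IsMatching H B := by
    refine ⟨fun b hb => ?_, fun b hb b' hb' h => ?_⟩
    · have := hM.1 _ (Finset.mem_filter.1 hb).2
      simpa [hι, hN] using this
    · refine ι.injective (hM.2 _ (Finset.mem_filter.1 hb).2 _ (Finset.mem_filter.1 hb').2 ?_)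
      simpa [hι, hσ.eq_iff] using h
  have hcards : B.card + O.card = M.card := by
    rw [← Finset.card_map ι, hBM, add_comm, hOdef]
    exact Finset.card_filter_add_card_filter_not _
  -- `M` covers every online node of the pushed-forward `B₀`, so its restriction to H is still
  -- maximum.
  have hge : B₀.card ≤ B.card := by
    have hsub : B₀.image Prod.fst ⊆ B.image Prod.fst := by
      intro p hp
      obtain ⟨b, hb, rfl⟩ := Finset.mem_image.1 hp
      obtain ⟨f, hf, hfe⟩ := hcov (ι b) (Finset.mem_map_of_mem ι hb)
      refine Finset.mem_image.2 ⟨(b.1, f.2), ?_, rfl⟩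
      simp only [hBdef, Finset.mem_filter, Finset.mem_univ, true_and]
      have : ι (b.1, f.2) = f := Prod.ext hfe.symm rfl
      rwa [this]
    have h1 := Finset.card_le_card hsub
    rw [Finset.card_image_of_injOn fun e he f hf h => hB₀.2 e he f hf (Or.inl h),
      Finset.card_image_of_injOn fun e he f hf h => hB.2 e he f hf (Or.inl h)] at h1
    exact h1
  refine ⟨B, O, hB, le_antisymm hB.card_le_matchingNumber (hB₀c ▸ hge),
    hM.mono (Finset.filter_subset _ _), hcards.trans hMc, fun e he => (Finset.mem_filter.1 he).2,
    ?_⟩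
  rw [Finset.disjoint_left]
  intro x hx hx'
  obtain ⟨e, he, rfl⟩ := Finset.mem_image.1 hx
  obtain ⟨b, hb, hbe⟩ := Finset.mem_image.1 hx'
  have he' := Finset.mem_filter.1 he
  have := hM.2 _ (Finset.mem_filter.1 hb).2 e he'.1 (Or.inr hbe)
  exact he'.2 b.1 (congrArg Prod.fst this)

/-! ### Identifying arrivals and simulating the algorithm -/

section Simulation

variable {V : Type*} {U : Type*} {P : Type*}

open Classical in
/-- The offline node that a matching assigns to `p`. -/
noncomputable def partner (M : Finset (P × U)) (p : P) : Option U :=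
  if h : ∃ x, (p, x) ∈ M then some h.choose else none

theorem partner_some {M : Finset (P × U)} {p : P} {x : U} (h : partner M p = some x) :
    (p, x) ∈ M := by
  unfold partner at h
  split_ifs at h with hex
  exact Option.some.inj h ▸ hex.choose_spec

theorem partner_none {M : Finset (P × U)} {p : P} (h : partner M p = none) (x : U) :
    (p, x) ∉ M := by
  unfold partner at h
  split_ifs at h with hex
  exact fun hx => hex ⟨x, hx⟩

variable [DecidableEq U]

open Classical in
/-- The awaited predicted node as which an arriving node is treated. -/
noncomputable def identify (H : P → Finset U) (Q : Finset P) (S : Finset U) : Option P :=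
  if h : ∃ p ∈ Q, H p = S then some h.choose else none

theorem identify_some {H : P → Finset U} {Q : Finset P} {S : Finset U} {p : P}
    (h : identify H Q S = some p) : p ∈ Q ∧ H p = S := by
  unfold identify at h
  split_ifs at h with hex
  exact Option.some.inj h ▸ hex.choose_spec

theorem identify_none {H : P → Finset U} {Q : Finset P} {S : Finset U}
    (h : identify H Q S = none) : ∀ p ∈ Q, H p ≠ S := by
  unfold identify at h
  split_ifs at h with hex
  exact fun p hp hpS => hex ⟨p, hp, hpS⟩

/-- Every awaited predicted node still has its own arrival among `vs`. -/
def Awaits (H : P → Finset U) (N : V → Finset U) (Q : Finset P) (vs : List V) : Prop :=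
  ∀ S, (Q.filter fun p => H p = S).card ≤ (vs.map N).count S

theorem Awaits.eq_empty {H : P → Finset U} {N : V → Finset U} {Q : Finset P}
    (h : Awaits H N Q []) : Q = ∅ := by
  refine Finset.eq_empty_of_forall_notMem fun p hp => ?_
  have := h (H p)
  simp only [List.map_nil, List.count_nil, Nat.le_zero, Finset.card_eq_zero] at this
  exact Finset.notMem_empty p (this ▸ Finset.mem_filter.2 ⟨hp, rfl⟩)

theorem Awaits.cons_none {H : P → Finset U} {N : V → Finset U} {Q : Finset P} {v : V}
    {vs : List V} (h : Awaits H N Q (v :: vs)) (hp : identify H Q (N v) = none) :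
    Awaits H N Q vs := by
  intro S
  have hS := h S
  rw [List.map_cons, List.count_cons] at hS
  by_cases e : N v = S
  · have : (Q.filter fun p => H p = S) = ∅ :=
      Finset.filter_eq_empty_iff.2 fun p hpQ hpS => identify_none hp p hpQ (hpS.trans e.symm)
    simp [this]
  · have : (N v == S) = false := by simpa using e
    rw [this] at hS
    simpa using hS

theorem step_some_of_free [DecidableEq V] {N : V → Finset U} {C : Finset (V × U)} {v : V} {x : U}
    (hx : x ∈ N v) (hfree : ∀ e ∈ C, e.2 ≠ x) : step N C v (some x) = insert (v, x) C := by
  rw [step, if_pos ⟨hx, hfree⟩]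
  ext z
  simp only [Finset.mem_insert]

variable [DecidableEq P]

/-- One step of the algorithm: `Q` are the awaited predicted nodes, `F` the free reserved offline
nodes. -/
noncomputable def transition (H : P → Finset U) (M : Finset (P × U)) (c : Finset U → Option U)
    (s : Finset P × Finset U) (S : Finset U) : (Finset P × Finset U) × Option U :=
  match identify H s.1 S with
  | some p => ((s.1.erase p, s.2), partner M p)
  | none =>
    match c (s.2 ∩ S) with
    | some x => ((s.1, s.2.erase x), some x)
    | none => (s, none)

/-- The strategy that serves predicted nodes by `M` and ranks the offline nodes outside of `M` for
the others. -/
noncomputable def reserveStrategy [Fintype P] [Fintype U] (H : P → Finset U)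
    (M : Finset (P × U)) (c : Finset U → Option U) : OnlineStrategy U := fun h S =>
  (transition H M c
    (h.foldl (fun s S => (transition H M c s S).1) (Finset.univ, (covered M)ᶜ)) S).2

/-- The arrivals that are not treated as predicted nodes. -/
noncomputable def unidentified (H : P → Finset U) (N : V → Finset U) : Finset P → List V → List V
  | _, [] => []
  | Q, v :: vs =>
    match identify H Q (N v) with
    | some p => unidentified H N (Q.erase p) vs
    | none => v :: unidentified H N Q vs

theorem unidentified_cons_some {H : P → Finset U} {N : V → Finset U} {Q : Finset P} {v : V}
    {vs : List V} {p : P} (h : identify H Q (N v) = some p) :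
    unidentified H N Q (v :: vs) = unidentified H N (Q.erase p) vs := by
  rw [unidentified, h]

theorem unidentified_cons_none {H : P → Finset U} {N : V → Finset U} {Q : Finset P} {v : V}
    {vs : List V} (h : identify H Q (N v) = none) :
    unidentified H N Q (v :: vs) = v :: unidentified H N Q vs := by
  rw [unidentified, h]

theorem Awaits.cons_some {H : P → Finset U} {N : V → Finset U} {Q : Finset P} {v : V}
    {vs : List V} (h : Awaits H N Q (v :: vs)) {p : P} (hp : identify H Q (N v) = some p) :
    Awaits H N (Q.erase p) vs := by
  intro S
  have hS := h S
  obtain ⟨hpQ, hpN⟩ := identify_some hp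
  rw [List.map_cons, List.count_cons] at hS
  rw [Finset.filter_erase]
  by_cases e : N v = S
  · have hmem : p ∈ Q.filter fun p => H p = S := Finset.mem_filter.2 ⟨hpQ, hpN.trans e⟩
    rw [Finset.card_erase_of_mem hmem]
    simp only [e, beq_self_eq_true, if_true] at hS
    omega
  · have : (N v == S) = false := by simpa using e
    rw [this] at hS
    exact (Finset.card_le_card (Finset.erase_subset _ _)).trans (by simpa using hS)

/-- The map `σ` sends each awaited node to the arrival that takes its place, possibly an adversarial
one with the same neighbourhood. `σ₀` only supplies values outside `Q`. -/
theorem exists_identification [DecidableEq V] {H : P → Finset U} {N : V → Finset U} (σ₀ : P → V)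
    (Q : Finset P) (vs : List V) (hvs : vs.Nodup) (h : Awaits H N Q vs) :
    ∃ σ : P → V, Set.InjOn σ Q ∧ (∀ p ∈ Q, σ p ∈ vs ∧ N (σ p) = H p) ∧
      ∀ v ∈ vs, v ∉ unidentified H N Q vs → ∃ p ∈ Q, σ p = v := by
  induction vs generalizing Q with
  | nil => exact ⟨σ₀, by simp [h.eq_empty]⟩
  | cons v vs ih =>
    obtain ⟨hv, hvs⟩ := List.nodup_cons.1 hvs
    cases hp : identify H Q (N v) with
    | none =>
      obtain ⟨σ, h1, h2, h3⟩ := ih Q hvs (h.cons_none hp)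
      refine ⟨σ, h1, fun p hp => ⟨List.mem_cons_of_mem _ (h2 p hp).1, (h2 p hp).2⟩, ?_⟩
      rw [unidentified_cons_none hp]
      intro a ha hna
      rw [List.mem_cons, not_or] at hna
      exact h3 a ((List.mem_cons.1 ha).resolve_left hna.1) hna.2
    | some p =>
      obtain ⟨σ, h1, h2, h3⟩ := ih _ hvs (h.cons_some hp)
      obtain ⟨hpQ, hpN⟩ := identify_some hp
      have hσ : ∀ q ∈ Q, q ≠ p → σ q ∈ vs ∧ N (σ q) = H q ∧ σ q ≠ v := fun q hq hqp => by
        have := h2 q (Finset.mem_erase.2 ⟨hqp, hq⟩)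
        exact ⟨this.1, this.2, fun e => hv (e ▸ this.1)⟩
      refine ⟨Function.update σ p v, ?_, ?_, ?_⟩
      · intro q hq r hr hqr
        by_cases hqp : q = p <;> by_cases hrp : r = p
        · rw [hqp, hrp]
        · subst hqp
          rw [Function.update_self, Function.update_of_ne hrp] at hqr
          exact absurd hqr.symm (hσ r hr hrp).2.2
        · subst hrp
          rw [Function.update_self, Function.update_of_ne hqp] at hqr
          exact absurd hqr (hσ q hq hqp).2.2
        · rw [Function.update_of_ne hqp, Function.update_of_ne hrp] at hqr
          exact h1 (Finset.mem_coe.2 (Finset.mem_erase.2 ⟨hqp, hq⟩))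
            (Finset.mem_coe.2 (Finset.mem_erase.2 ⟨hrp, hr⟩)) hqr
      · intro q hq
        by_cases hqp : q = p
        · subst hqp; simp [hpN]
        · rw [Function.update_of_ne hqp]
          exact ⟨List.mem_cons_of_mem _ (hσ q hq hqp).1, (hσ q hq hqp).2.1⟩
      · rw [unidentified_cons_some hp]
        intro a ha hna
        rcases List.mem_cons.1 ha with rfl | ha
        · exact ⟨p, hpQ, by simp⟩
        · obtain ⟨q, hq, rfl⟩ := h3 a ha hna
          have := Finset.mem_erase.1 hq
          exact ⟨q, this.2, Function.update_of_ne this.1 _ _⟩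

/-- Invariant: the current matching avoids the free set `F` and the `M`-partners of awaited nodes,
so no answer of the strategy is ever rejected. `Awaits` ensures that every awaited node is
eventually served. -/
theorem card_runFrom [DecidableEq V] {H : P → Finset U} {N : V → Finset U} {M : Finset (P × U)}
    (hM : IsMatching H M) {c : Finset U → Option U} (hc : ∀ S x, c S = some x → x ∈ S)
    {s₀ : Finset P × Finset U} {A : OnlineStrategy U}
    (hA : ∀ h S, A h S =
      (transition H M c (h.foldl (fun s S => (transition H M c s S).1) s₀) S).2)
    (vs : List V) (Q : Finset P) (F : Finset U) (h : List (Finset U)) (C : Finset (V × U))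
    (hs : h.foldl (fun s S => (transition H M c s S).1) s₀ = (Q, F)) (hQ : Awaits H N Q vs)
    (hCF : ∀ e ∈ C, e.2 ∉ F) (hMF : Disjoint (covered M) F)
    (hCM : ∀ e ∈ C, ∀ b ∈ M, b.1 ∈ Q → e.2 ≠ b.2) :
    (runFrom A N h C vs).card = C.card + (M.filter fun b => b.1 ∈ Q).card +
      (greedy c N F (unidentified H N Q vs)).card := by
  induction vs generalizing Q F h C with
  | nil => simp [runFrom, unidentified, greedy, hQ.eq_empty]
  | cons v vs ih =>
    have hA' : A h (N v) = (transition H M c (Q, F) (N v)).2 := by rw [hA, hs]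
    have hs' : (h ++ [N v]).foldl (fun s S => (transition H M c s S).1) s₀ =
        (transition H M c (Q, F) (N v)).1 := by rw [List.foldl_append, hs]; rfl
    rw [runFrom, hA']
    cases hp : identify H Q (N v) with
    | some p =>
      obtain ⟨hpQ, hpN⟩ := identify_some hp
      have ht : transition H M c (Q, F) (N v) = ((Q.erase p, F), partner M p) := by
        simp [transition, hp]
      rw [ht] at hs' ⊢
      rw [unidentified_cons_some hp]
      have hCM' : ∀ e ∈ C, ∀ b ∈ M, b.1 ∈ Q.erase p → e.2 ≠ b.2 := fun e he b hb hbQ =>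
        hCM e he b hb (Finset.mem_of_mem_erase hbQ)
      cases hx : partner M p with
      | none =>
        have hf : (M.filter fun b => b.1 ∈ Q) = M.filter fun b => b.1 ∈ Q.erase p := by
          refine Finset.filter_congr fun b hb => ?_
          have : b.1 ≠ p := fun e => partner_none hx b.2 (e ▸ hb)
          simp [this]
        rw [hf]
        exact ih (Q.erase p) F _ _ hs' (hQ.cons_some hp) hCF hMF hCM'
      | some x =>
        have hxM := partner_some hx
        have hxC : ∀ e ∈ C, e.2 ≠ x := fun e he => hCM e he _ hxM hpQ
        have hstep : step N C v (some x) = insert (v, x) C :=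
          step_some_of_free (hpN ▸ hM.1 _ hxM) hxC
        have hnot : (v, x) ∉ C := fun h => hxC _ h rfl
        have hf : (M.filter fun b => b.1 ∈ Q) =
            insert (p, x) (M.filter fun b => b.1 ∈ Q.erase p) := by
          ext b
          simp only [Finset.mem_filter, Finset.mem_insert, Finset.mem_erase]
          constructor
          · rintro ⟨hb, hbQ⟩
            by_cases e : b.1 = p
            · exact Or.inl (hM.2 b hb _ hxM (Or.inl e))
            · exact Or.inr ⟨hb, e, hbQ⟩
          · rintro (rfl | ⟨hb, -, hbQ⟩)
            exacts [⟨hxM, hpQ⟩, ⟨hb, hbQ⟩]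
        rw [hstep, hf, Finset.card_insert_of_notMem (by simp)]
        rw [ih (Q.erase p) F _ _ hs' (hQ.cons_some hp) ?_ hMF ?_,
          Finset.card_insert_of_notMem hnot]
        · omega
        · intro e he
          rcases Finset.mem_insert.1 he with rfl | he
          · exact Finset.disjoint_left.1 hMF (Finset.mem_image_of_mem Prod.snd hxM)
          · exact hCF e he
        · intro e he b hb hbQ
          rcases Finset.mem_insert.1 he with rfl | he
          · intro hxb
            have := hM.2 _ hxM b hb (Or.inr hxb)
            exact (Finset.mem_erase.1 hbQ).1 (congrArg Prod.fst this).symm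
          · exact hCM' e he b hb hbQ
    | none =>
      rw [unidentified_cons_none hp]
      cases hx : c (F ∩ N v) with
      | none =>
        have ht : transition H M c (Q, F) (N v) = ((Q, F), none) := by
          simp [transition, hp, hx]
        rw [ht] at hs' ⊢
        rw [greedy_cons_none hx]
        exact ih Q F _ _ hs' (hQ.cons_none hp) hCF hMF hCM
      | some x =>
        have ht : transition H M c (Q, F) (N v) = ((Q, F.erase x), some x) := by
          simp [transition, hp, hx]
        rw [ht] at hs' ⊢
        obtain ⟨hxF, hxN⟩ := Finset.mem_inter.1 (hc _ _ hx)
        have hxC : ∀ e ∈ C, e.2 ≠ x := fun e he h => hCF e he (h ▸ hxF)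
        have hstep : step N C v (some x) = insert (v, x) C :=
          step_some_of_free hxN hxC
        rw [hstep, card_greedy_cons_some hc hx]
        rw [ih Q (F.erase x) _ _ hs' (hQ.cons_none hp) ?_
          (hMF.mono_right (Finset.erase_subset _ _)) ?_,
          Finset.card_insert_of_notMem fun h => hxC _ h rfl]
        · omega
        · intro e he
          rcases Finset.mem_insert.1 he with rfl | he
          · simp
          · exact fun h => hCF e he (Finset.mem_of_mem_erase h)
        · intro e he b hb hbQ
          rcases Finset.mem_insert.1 he with rfl | he
          · exact fun h => Finset.disjoint_left.1 hMF (Finset.mem_image_of_mem Prod.snd hb)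
              (h ▸ hxF)
          · exact hCM e he b hb hbQ

theorem card_run [DecidableEq V] [Fintype P] [Fintype U] {H : P → Finset U} {N : V → Finset U}
    {M : Finset (P × U)} (hM : IsMatching H M) {c : Finset U → Option U}
    (hc : ∀ S x, c S = some x → x ∈ S) (vs : List V) (hvs : Awaits H N Finset.univ vs) :
    (run (reserveStrategy H M c) N vs).card =
      M.card + (greedy c N (covered M)ᶜ (unidentified H N Finset.univ vs)).card := by
  rw [run, card_runFrom (A := reserveStrategy H M c) hM hc
    (s₀ := (Finset.univ, (covered M)ᶜ)) (fun _ _ => rfl) vs Finset.univ (covered M)ᶜ [] ∅ rfl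
    hvs (by simp) disjoint_compl_right (by simp)]
  simp

theorem awaits_fullGraph [Fintype P] (H : P → Finset U) {d : ℕ} (adv : Fin d → Finset U)
    {order : List (P ⊕ Fin d)} (hmem : ∀ x, x ∈ order) :
    Awaits H (fullGraph H adv) Finset.univ order := by
  intro S
  rw [List.count, List.countP_map, List.countP_eq_length_filter]
  refine le_trans ?_ (List.toFinset_card_le _)
  refine Finset.card_le_card_of_injOn Sum.inl (fun p hp => ?_) Sum.inl_injective.injOn
  have := (Finset.mem_filter.1 (Finset.mem_coe.1 hp)).2
  simp [hmem, fullGraph, this]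

end Simulation

/-! ### Assembling the algorithm -/

/-- A real-weighted mixture of finitely many elements as a probability mass function. -/
theorem exists_pmf_of_stdSimplex {I : Type*} {S : Type*} [Fintype I] {p : I → ℝ}
    (hp : p ∈ stdSimplex ℝ I) (f : I → S) :
    ∃ A : PMF S, ∀ F : S → ℝ, ∑' s, (A s).toReal * F s = ∑ i, p i * F (f i) := by
  classical
  have h1 : ∑ i, ENNReal.ofReal (p i) = 1 := by
    rw [← ENNReal.ofReal_sum_of_nonneg fun i _ => hp.1 i, hp.2, ENNReal.ofReal_one]
  refine ⟨(PMF.ofFintype _ h1).map f, fun F => ?_⟩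
  have hA : ∀ s, (((PMF.ofFintype _ h1).map f) s).toReal * F s =
      ∑ i, if s = f i then p i * F s else 0 := by
    intro s
    rw [PMF.map_apply, tsum_fintype, ENNReal.toReal_sum
      fun i _ => by split_ifs <;> simp [PMF.ofFintype_apply], Finset.sum_mul]
    refine Finset.sum_congr rfl fun i _ => ?_
    split_ifs <;> simp [PMF.ofFintype_apply, ENNReal.toReal_ofReal (hp.1 i)]
  simp_rw [hA]
  rw [Summable.tsum_finsetSum fun i _ => (hasSum_ite_eq (f i) (p i * F (f i))).summable.congr
    fun s => ?_]
  · refine Finset.sum_congr rfl fun i _ => ?_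
    rw [tsum_eq_single (f i) fun s hs => if_neg hs, if_pos rfl]
  · split_ifs with h
    · rw [h]
    · rfl

/-- Reserving the offline nodes that a fairly drawn maximum matching of the predicted graph leaves
free, and ranking them. -/
theorem exists_semiOnline_algorithm (U : Type u) (P : Type v) [Fintype U] [Fintype P]
    (H : P → Finset U) : ∃ A : PMF (OnlineStrategy U), ∀ (d : ℕ) (adv : Fin d → Finset U)
      (order : List (P ⊕ Fin d)), order.Nodup → (∀ x, x ∈ order) →
      (1 - delta H adv + delta H adv ^ 2 * (1 - 1 / Real.exp 1)) *
        (matchingNumber (fullGraph H adv) : ℝ) ≤ expectedSize A (fullGraph H adv) order := by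
  classical
  let I := {M : Finset (P × U) // IsMatching H M ∧ M.card = matchingNumber H}
  obtain ⟨M₁, hM₁⟩ := exists_isMatching_card_eq H
  have : Nonempty I := ⟨⟨M₁, hM₁⟩⟩
  obtain ⟨w, hw, hfair⟩ := exists_fair_distribution fun M : I => covered M.1
  obtain ⟨μ, hμ, hμc, hrank⟩ := exists_ranking_distribution.{u, v} U
  have hp : (fun z : I × (Finset U → Option U) => w z.1 * μ z.2) ∈ stdSimplex ℝ _ := by
    refine ⟨fun z => mul_nonneg (hw.1 _) (hμ.1 _), ?_⟩
    rw [Fintype.sum_prod_type]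
    simp only [← Finset.mul_sum, hμ.2, hw.2, mul_one]
  obtain ⟨A, hA⟩ := exists_pmf_of_stdSimplex hp fun z => reserveStrategy H z.1.1 z.2
  refine ⟨A, fun d adv order hnd hmem => ?_⟩
  rw [expectedSize, hA]
  set N := fullGraph H adv with hN
  have haw := awaits_fullGraph H adv hmem
  rw [← hN] at haw
  -- From here the image of `σ` plays the part of the predicted nodes, so all edges of `O` sit at
  -- arrivals that RANKING serves.
  obtain ⟨σ, hσ, hσN, hσv⟩ := exists_identification Sum.inl Finset.univ order hnd haw
  rw [Finset.coe_univ, Set.injOn_univ] at hσ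
  obtain ⟨B, O, hB, hBc, hO, hcard, hOσ, hdisj⟩ :=
    exists_split_maximum hσ fun p => (hσN p (Finset.mem_univ _)).2
  have hOv : ∀ e ∈ O, e.1 ∈ unidentified H N Finset.univ order := by
    intro e he
    by_contra hno
    obtain ⟨p, -, hp⟩ := hσv e.1 (hmem _) hno
    exact hOσ e he p hp
  set κ : ℝ := 1 - 1 / Real.exp 1 with hκ
  have hκ0 : 0 ≤ κ := by
    rw [hκ, sub_nonneg, div_le_one (Real.exp_pos 1)]
    exact Real.one_le_exp zero_le_one
  have hrow : ∀ M : I, (matchingNumber H : ℝ) + κ * ∑ e ∈ O, (if e.2 ∈ covered M.1 then 0 else 1) ≤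
      ∑ c, μ c * ((run (reserveStrategy H M.1 c) N order).card : ℝ) := by
    intro M
    have h1 : ∀ c, μ c * ((run (reserveStrategy H M.1 c) N order).card : ℝ) =
        μ c * (matchingNumber H : ℝ) + μ c *
          ((greedy c N (covered M.1)ᶜ (unidentified H N Finset.univ order)).card : ℝ) := by
      intro c
      -- Rules of weight zero may choose outside their argument, where `card_run` does not apply.
      by_cases hc : μ c = 0
      · simp [hc]
      · rw [card_run M.2.1 (hμc c hc) order haw, M.2.2]
        push_cast
        ring
    simp_rw [h1]
    rw [Finset.sum_add_distrib, ← Finset.sum_mul, hμ.2, one_mul]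
    have h2 := hrank _ N (covered M.1)ᶜ (unidentified H N Finset.univ order)
      (O.filter fun e => e.2 ∉ covered M.1) (hO.mono (Finset.filter_subset _ _)) fun f hf => by
        have := Finset.mem_filter.1 hf
        exact ⟨hOv f this.1, Finset.mem_compl.2 this.2⟩
    have h3 : ∑ e ∈ O, (if e.2 ∈ covered M.1 then (0 : ℝ) else 1) =
        (O.filter fun e => e.2 ∉ covered M.1).card := by
      rw [← Finset.sum_boole]
      exact Finset.sum_congr rfl fun e _ => by split_ifs <;> rfl
    rw [h3]
    linarith
  have hexp : (matchingNumber H : ℝ) +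
      κ * ∑ x ∈ covered O, ∑ M : I, w M * (if x ∈ covered M.1 then 0 else 1) ≤
      ∑ z : I × (Finset U → Option U), w z.1 * μ z.2 *
        ((run (reserveStrategy H z.1.1 z.2) N order).card : ℝ) := by
    rw [Fintype.sum_prod_type]
    simp only [mul_assoc, ← Finset.mul_sum]
    refine le_trans (le_of_eq ?_) (Finset.sum_le_sum fun M _ =>
      mul_le_mul_of_nonneg_left (hrow M) (hw.1 M))
    simp only [mul_add, Finset.sum_add_distrib]
    rw [← Finset.sum_mul, hw.2, one_mul, covered,
      Finset.sum_image fun e he f hf h => hO.2 e he f hf (Or.inr h), Finset.sum_comm,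
      Finset.mul_sum]
    congr 1
    refine Finset.sum_congr rfl fun M _ => ?_
    rw [← Finset.mul_sum]
    ring
  have hf := hfair ⟨B, hB, hBc⟩ (covered O) hdisj
  simp only at hf
  rw [hO.card_covered, hB.card_covered] at hf
  refine le_trans ?_ hexp
  set s := ∑ x ∈ covered O, ∑ M : I, w M * (if x ∈ covered M.1 then (0 : ℝ) else 1) with hs
  have hs0 : 0 ≤ s := Finset.sum_nonneg fun x _ => Finset.sum_nonneg fun M _ =>
    mul_nonneg (hw.1 M) (by split_ifs <;> norm_num)
  have hn : (matchingNumber H : ℝ) + O.card = matchingNumber N := by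
    rw [← hBc]; exact_mod_cast hcard
  have hBc' : (B.card : ℝ) = matchingNumber H := by exact_mod_cast hBc
  rw [hBc', hn] at hf
  rw [delta, ← hN]
  -- For ν(G) = 0, division by zero makes `delta` equal to 1, but the factor ν(G) makes the bound 0.
  rcases Nat.eq_zero_or_pos (matchingNumber N) with h0 | hpos
  · rw [h0]
    simp only [Nat.cast_zero, mul_zero]
    positivity
  · have hpos' : (0 : ℝ) < matchingNumber N := by exact_mod_cast hpos
    have h1 : (O.card : ℝ) ^ 2 / matchingNumber N ≤ s := (div_le_iff₀ hpos').2 hf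
    have hδ : 1 - (matchingNumber H : ℝ) / matchingNumber N = O.card / matchingNumber N := by
      rw [← hn] at hpos' ⊢
      field_simp
      ring
    have h2 : (1 - (1 - (matchingNumber H : ℝ) / matchingNumber N) +
        (1 - (matchingNumber H : ℝ) / matchingNumber N) ^ 2 * κ) * matchingNumber N =
        matchingNumber H + κ * ((O.card : ℝ) ^ 2 / matchingNumber N) := by
      rw [sub_sub_cancel, hδ]
      field_simp
    rw [h2]
    have := mul_le_mul_of_nonneg_left h1 hκ0
    linarith

end SemiOnline

theorem mainTheorem2 :
    ∃ A : SemiOnline.RandomizedAlgorithm,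
      ∀ (U : Type*) (P : Type*) [Fintype U] [Fintype P]
        (H : P → Finset U) (d : ℕ) (adv : Fin d → Finset U)
        (order : List (P ⊕ Fin d)), order.Nodup → (∀ x, x ∈ order) →
        (1 - SemiOnline.delta H adv + SemiOnline.delta H adv ^ 2 * (1 - 1 / Real.exp 1)) *
            (SemiOnline.matchingNumber (SemiOnline.fullGraph H adv) : ℝ)
          ≤ SemiOnline.expectedSize (A U P H) (SemiOnline.fullGraph H adv) order :=
  ⟨fun U P _ _ H => (SemiOnline.exists_semiOnline_algorithm U P H).choose,
    fun U P _ _ H => (SemiOnline.exists_semiOnline_algorithm U P H).choose_spec⟩
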